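/- Let $n \ge 1$ be an integer and let $\mu$ be a mean-zero Gaussian measure on $\mathbb{R}^n$, that is, an image $\mu = A_{*}\gamma_n$ of the standard Gaussian measure $\gamma_n(B) = (2\pi)^{-n/2}\int_B e^{-|x|^2/2}\,dx$ under a linear map $A : \mathbb{R}^n \to \mathbb{R}^n$, possibly not invertible (equivalently, a Borel probability measure with mean $0$ whose image under every linear functional is a possibly degenerate Gaussian measure on $\mathbb{R}$). Let $K, M \subseteq \mathbb{R}^n$ be closed convex sets that are symmetric about the origin, i.e. $K = -K$ and $M = -M$. Then $$\mu(K \cap M) \ge \mu(K)\,\mu(M).$$ -/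

import Mathlib

namespace GaussianCorrelation

open Matrix MeasureTheory ProbabilityTheory Set Filter
open scoped MatrixOrder RealInnerProductSpace Topology Polynomial

/-! ### Determinants along the interpolation of a covariance matrix -/

section LinearAlgebra

variable {ι : Type*} [Fintype ι] [DecidableEq ι]

/-! Royen's argument. A nonempty symmetric closed convex set is a countable intersection of strips
`|⟪v, x⟫| ≤ 1`, so finitely many strips suffice. Their indicator is a limit of products of factors
f(⟪v i, x⟫²), where f is a combination of exponentials, nonnegative and nonincreasing on [0, ∞).

Let C(t) be the joint covariance matrix of the functionals for both sets, with cross-covariances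
multiplied by t. At t = 1 it is the true one, at t = 0 the two families are independent, so it is
enough that the expected product be nondecreasing in t (`monotoneOn_sum_inv_sqrt_det`). By the
Laplace transform it is a combination of terms det(1 + ΛC(t))^(-1/2), with det(1 + ΛC(t)) = ∑_J λ_J
det C_J(t). Its derivative is a sum over J of -½ (det C_J)' times a combination of λ_J det(1 +
ΛC(t))^(-3/2). The first factor is nonnegative by `antitoneOn_det_interp`. In the second, the power
-3/2 is a Laplace transform for three independent copies, and λ_J replaces f by -2f' ≥ 0 at the
indices in J (`sum_mul_inv_sqrt_det_pow_three_nonneg`). -/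

lemma det_one_add_smul {K : Matrix ι ι ℝ} (hK : K.IsHermitian) (t : ℝ) :
    (1 + t • K).det = ∏ i, (1 + t * hK.eigenvalues i) := by
  have h : 1 + t • K = (hK.eigenvectorUnitary : Matrix ι ι ℝ) *
      (1 + t • diagonal hK.eigenvalues) * star (hK.eigenvectorUnitary : Matrix ι ι ℝ) := by
    conv_lhs => rw [hK.spectral_theorem]
    simp [Unitary.conjStarAlgAut_apply, mul_add, add_mul]
  have h2 : 1 + t • diagonal hK.eigenvalues = diagonal fun i ↦ 1 + t * hK.eigenvalues i := by
    rw [← diagonal_one, ← diagonal_smul, diagonal_add]; rfl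
  rw [h, det_mul_comm, ← mul_assoc, Unitary.coe_star_mul_self, one_mul, h2, det_diagonal]

/-- The principal submatrix of `C` on `J`, padded with the identity. -/
noncomputable def padded (J : Finset ι) (C : Matrix ι ι ℝ) : Matrix ι ι ℝ :=
  1 + diagonal (fun i ↦ if i ∈ J then 1 else 0) * (C - 1) *
    diagonal (fun i ↦ if i ∈ J then 1 else 0)

/-- Multilinearity in the rows: J records which rows come from the second summand, and what remains
is a principal minor of `C`. -/
lemma det_one_add_diagonal_mul (l : ι → ℝ) (C : Matrix ι ι ℝ) :
    (1 + diagonal l * C).det = ∑ J : Finset ι, (∏ i ∈ J, l i) * (padded J C).det := by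
  have h := (detRowAlternating (n := ι) (R := ℝ)).toMultilinearMap.map_add_univ
    (fun i ↦ l i • C i) (1 : Matrix ι ι ℝ)
  have h1 : 1 + diagonal l * C = Matrix.of (fun i ↦ l i • C i) + (1 : Matrix ι ι ℝ) := by
    ext i j; simp [add_comm]
  rw [h1]
  refine h.trans (Finset.sum_congr rfl fun J _ ↦ ?_)
  have h2 : J.piecewise (fun i ↦ l i • C i) (1 : Matrix ι ι ℝ) =
      fun i ↦ (J.piecewise l 1) i • (J.piecewise C (1 : Matrix ι ι ℝ)) i := by
    ext i j; by_cases hi : i ∈ J <;> simp [Finset.piecewise, hi]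
  rw [h2]
  refine ((detRowAlternating (n := ι) (R := ℝ)).toMultilinearMap.map_smul_univ _ _).trans ?_
  rw [smul_eq_mul]
  congr 1
  · simp [Finset.prod_piecewise]
  · change det (J.piecewise C (1 : Matrix ι ι ℝ)) = _
    set P : Matrix ι ι ℝ := diagonal (fun i ↦ if i ∈ J then 1 else 0) with hP
    have hPP : P * P = P := by simp [hP]
    -- Since P is idempotent, det(1 + AB) = det(1 + BA) moves one copy of P to the right and clears
    -- the columns outside J.
    have h3 : J.piecewise C (1 : Matrix ι ι ℝ) =
        (1 + P * (P * (C - (1 : Matrix ι ι ℝ))) : Matrix ι ι ℝ) := by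
      rw [← mul_assoc, hPP]
      ext i j; by_cases hi : i ∈ J <;> simp [Finset.piecewise, hi, hP]
    rw [h3, det_one_add_mul_comm, padded]

/-- The matrix obtained from `M` by multiplying by `t` the entries at indices with opposite signs. -/
noncomputable def interp (σ : ι → ℝ) (M : Matrix ι ι ℝ) (t : ℝ) : Matrix ι ι ℝ :=
  ((1 + t) / 2) • M + ((1 - t) / 2) • (diagonal σ * M * diagonal σ)

lemma interp_one (σ : ι → ℝ) (M : Matrix ι ι ℝ) : interp σ M 1 = M := by
  simp [interp]

lemma posSemidef_interp {σ : ι → ℝ} {M : Matrix ι ι ℝ} (hM : M.PosSemidef) {t : ℝ}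
    (ht : t ∈ Icc (-1 : ℝ) 1) : (interp σ M t).PosSemidef := by
  have h := hM.conjTranspose_mul_mul_same (diagonal σ)
  simp only [diagonal_conjTranspose, star_trivial] at h
  exact (hM.smul (by linarith [ht.1])).add (h.smul (by linarith [ht.2]))

lemma posSemidef_padded (J : Finset ι) {C : Matrix ι ι ℝ} (hC : C.PosSemidef) :
    (padded J C).PosSemidef := by
  have h := hC.conjTranspose_mul_mul_same (diagonal (fun i ↦ if i ∈ J then (1 : ℝ) else 0))
  simp only [diagonal_conjTranspose, star_trivial] at h
  have h2 : (diagonal (fun i ↦ if i ∈ J then (0 : ℝ) else 1)).PosSemidef :=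
    PosSemidef.diagonal fun i ↦ by dsimp; split_ifs <;> norm_num
  convert h2.add h using 1
  rw [padded]
  ext i j
  by_cases hi : i ∈ J <;> by_cases hj : j ∈ J <;> by_cases hij : i = j <;>
    simp_all [one_apply]

/-- Diagonal entries do not depend on t, so every principal minor of the interpolation is itself the
determinant of an interpolation. -/
lemma padded_interp {σ : ι → ℝ} (hσ : ∀ i, σ i * σ i = 1) (J : Finset ι)
    (C : Matrix ι ι ℝ) (t : ℝ) :
    padded J (interp σ C t) = interp σ (padded J C) t := by
  ext i j
  by_cases hij : i = j
  · subst hij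
    simp only [padded, interp, Matrix.add_apply, diagonal_mul, mul_diagonal, Matrix.smul_apply, Matrix.sub_apply,
      one_apply_eq, smul_eq_mul]
    split_ifs
    · ring
    · linear_combination (-(1 - t) / 2) * hσ i
  · simp [padded, interp, hij]
    split_ifs <;> ring

lemma det_interp_neg {σ : ι → ℝ} (hσ : ∀ i, σ i * σ i = 1) (M : Matrix ι ι ℝ) (t : ℝ) :
    (interp σ M (-t)).det = (interp σ M t).det := by
  have h : interp σ M (-t) = diagonal σ * interp σ M t * diagonal σ := by
    ext i j
    simp only [interp, Matrix.add_apply, diagonal_mul, mul_diagonal, Matrix.smul_apply, smul_eq_mul]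
    linear_combination (-(1 - t) / 2 * M i j) * (σ j * σ j * hσ i + hσ j)
  have h2 : (diagonal σ).det * (diagonal σ).det = 1 := by
    rw [det_diagonal, ← Finset.prod_mul_distrib]; simp [hσ]
  rw [h, det_mul, det_mul]
  linear_combination (interp σ M t).det * h2

lemma posDef_interp_zero {σ : ι → ℝ} {M : Matrix ι ι ℝ} (hM : M.PosDef) :
    (interp σ M 0).PosDef := by
  have h := hM.posSemidef.conjTranspose_mul_mul_same (diagonal σ)
  simp only [diagonal_conjTranspose, star_trivial] at h
  exact (hM.smul (by norm_num)).add_posSemidef (h.smul (by norm_num))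

/-- The interpolation is affine in t, hence equals R(1 + tK)R with R² its value at 0. Positivity at
t = ±1 puts the eigenvalues κ of K in [-1, 1], and evenness in t makes the squared determinant a
constant times ∏(1 - t²κ²). -/
lemma antitoneOn_det_interp_of_posDef {σ : ι → ℝ} (hσ : ∀ i, σ i * σ i = 1) {M : Matrix ι ι ℝ}
    (hM : M.PosDef) : AntitoneOn (fun t ↦ (interp σ M t).det) (Icc 0 1) := by
  set A := interp σ M 0 with hA
  have hApd : A.PosDef := posDef_interp_zero hM
  set R := CFC.sqrt A with hR
  have hRR : R * R = A := CFC.sqrt_mul_sqrt_self _ hApd.posSemidef.nonneg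
  have hRh : R.IsHermitian := (CFC.sqrt_nonneg A).isSelfAdjoint
  have hRu : IsUnit R.det := by
    have : R.det * R.det = A.det := by rw [← det_mul, hRR]
    refine isUnit_iff_ne_zero.2 fun h ↦ hApd.det_pos.ne' ?_
    rw [← this, h, zero_mul]
  set N := M - A with hN
  have hNh : N.IsHermitian := hM.isHermitian.sub hApd.isHermitian
  set K := R⁻¹ * N * R⁻¹ with hK
  have hKh : K.IsHermitian := by
    have := isHermitian_conjTranspose_mul_mul R⁻¹ hNh
    rwa [hRh.inv.eq] at this
  have key (t : ℝ) : interp σ M t = R * (1 + t • K) * R := by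
    have h1 : R * (1 + t • K) * R = R * R + t • ((R * R⁻¹) * N * (R⁻¹ * R)) := by
      simp only [hK, mul_add, add_mul, mul_one, mul_smul_comm, smul_mul_assoc, mul_assoc]
    rw [h1, hRR, mul_nonsing_inv _ hRu, nonsing_inv_mul _ hRu, one_mul, mul_one, hN, hA]
    ext i j
    simp only [interp, Matrix.add_apply, diagonal_mul, mul_diagonal, Matrix.smul_apply, smul_eq_mul, Matrix.sub_apply]
    ring
  have hpsd {t : ℝ} (ht : t ∈ Icc (-1 : ℝ) 1) : (1 + t • K).PosSemidef := by
    have h := (posSemidef_interp (σ := σ) hM.posSemidef ht).conjTranspose_mul_mul_same R⁻¹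
    rw [key, hRh.inv.eq] at h
    have h2 : R⁻¹ * (R * (1 + t • K) * R) * R⁻¹ = (R⁻¹ * R) * (1 + t • K) * (R * R⁻¹) := by
      simp only [mul_assoc]
    rwa [h2, mul_nonsing_inv _ hRu, nonsing_inv_mul _ hRu, one_mul, mul_one] at h
  have hev (i : ι) : hKh.eigenvalues i ^ 2 ≤ 1 := by
    have hv : (0 : ℝ) < (hKh.eigenvectorBasis i).ofLp ⬝ᵥ (hKh.eigenvectorBasis i).ofLp := by
      have h : (hKh.eigenvectorBasis i).ofLp ≠ 0 := fun h ↦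
        hKh.eigenvectorBasis.toBasis.ne_zero i (by ext j; simpa using congrFun h j)
      simpa using dotProduct_star_self_pos_iff.2 h
    have h (t : ℝ) (ht : t ∈ Icc (-1 : ℝ) 1) : 0 ≤ 1 + t * hKh.eigenvalues i := by
      have := (hpsd ht).dotProduct_mulVec_nonneg (hKh.eigenvectorBasis i).ofLp
      rw [add_mulVec, smul_mulVec, hKh.mulVec_eigenvectorBasis, star_trivial, one_mulVec,
        dotProduct_add, dotProduct_smul, dotProduct_smul, smul_eq_mul, smul_eq_mul] at this
      exact nonneg_of_mul_nonneg_left (by linarith) hv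
    have h1 := h 1 (by norm_num)
    have h2 := h (-1) (by norm_num)
    nlinarith
  have hsq (t : ℝ) : (interp σ M t).det ^ 2 =
      A.det ^ 2 * ∏ i, (1 - t ^ 2 * hKh.eigenvalues i ^ 2) := by
    have h1 : (interp σ M t).det ^ 2 = (interp σ M t).det * (interp σ M (-t)).det := by
      rw [det_interp_neg hσ]; ring
    rw [h1, key, key, det_mul, det_mul, det_mul, det_mul, det_one_add_smul hKh, det_one_add_smul hKh,
      ← hRR, det_mul]
    have h2 : ∏ i, (1 - t ^ 2 * hKh.eigenvalues i ^ 2) =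
        (∏ i, (1 + t * hKh.eigenvalues i)) * ∏ i, (1 + -t * hKh.eigenvalues i) := by
      rw [← Finset.prod_mul_distrib]
      exact Finset.prod_congr rfl fun i _ ↦ by ring
    rw [h2]; ring
  intro s hs t ht hst
  have hnn : 0 ≤ (interp σ M s).det :=
    (posSemidef_interp hM.posSemidef ⟨by linarith [hs.1], hs.2⟩).det_nonneg
  refine le_of_sq_le_sq ?_ hnn
  change (interp σ M t).det ^ 2 ≤ (interp σ M s).det ^ 2
  rw [hsq s, hsq t]
  refine mul_le_mul_of_nonneg_left (Finset.prod_le_prod (fun i _ ↦ ?_) fun i _ ↦ ?_) (sq_nonneg A.det)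
  · nlinarith [hev i, sq_nonneg (hKh.eigenvalues i), pow_le_one₀ ht.1 ht.2 (n := 2)]
  · nlinarith [sq_nonneg (hKh.eigenvalues i), pow_le_pow_left₀ hs.1 hst 2]

lemma continuous_det_interp_add (σ : ι → ℝ) (M : Matrix ι ι ℝ) (t : ℝ) :
    Continuous fun ε : ℝ ↦ (interp σ (M + ε • 1) t).det := by
  unfold interp; fun_prop

lemma antitoneOn_det_interp {σ : ι → ℝ} (hσ : ∀ i, σ i * σ i = 1) {M : Matrix ι ι ℝ}
    (hM : M.PosSemidef) : AntitoneOn (fun t ↦ (interp σ M t).det) (Icc 0 1) := by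
  intro s hs t ht hst
  have h (r : ℝ) : Filter.Tendsto (fun ε : ℝ ↦ (interp σ (M + ε • 1) r).det)
      (nhdsWithin 0 (Ioi 0)) (nhds (interp σ M r).det) := by
    have := ((continuous_det_interp_add σ M r).tendsto 0).mono_left
      (nhdsWithin_le_nhds (s := Ioi 0))
    simpa using this
  refine le_of_tendsto_of_tendsto (h t) (h s) ?_
  filter_upwards [self_mem_nhdsWithin] with ε hε
  exact antitoneOn_det_interp_of_posDef hσ
    (PosDef.posSemidef_add hM (PosDef.one.smul hε)) hs ht hst

lemma differentiable_det_interp (σ : ι → ℝ) (M : Matrix ι ι ℝ) :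
    Differentiable ℝ fun t ↦ (interp σ M t).det := by
  simp only [det_apply', interp, Matrix.add_apply, Matrix.smul_apply, smul_eq_mul]
  fun_prop

end LinearAlgebra

/-! ### Laplace transforms of squares of Gaussian coordinates -/

section Laplace

variable {ι : Type*} [Fintype ι] [DecidableEq ι]

lemma integral_exp_neg_mul_sq_gaussianReal {d : ℝ} (hd : 0 ≤ d) :
    ∫ x, Real.exp (-(d * x ^ 2) / 2) ∂(gaussianReal 0 1) = (√(1 + d))⁻¹ := by
  have h (x : ℝ) : gaussianPDFReal 0 1 x • Real.exp (-(d * x ^ 2) / 2) =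
      (√(2 * Real.pi))⁻¹ * Real.exp (-((1 + d) / 2) * x ^ 2) := by
    simp only [gaussianPDFReal, smul_eq_mul, NNReal.coe_one, mul_one, sub_zero, mul_assoc,
      ← Real.exp_add]
    ring_nf
  rw [integral_gaussianReal_eq_integral_smul one_ne_zero]
  simp_rw [h]
  rw [integral_const_mul, integral_gaussian, ← Real.sqrt_inv, ← Real.sqrt_inv,
    ← Real.sqrt_mul (by positivity)]
  congr 1
  field_simp

lemma integral_exp_quadratic_stdGaussian {S : Matrix ι ι ℝ} (hS : S.PosSemidef) :
    ∫ x : EuclideanSpace ℝ ι, Real.exp (-(x.ofLp ⬝ᵥ S *ᵥ x.ofLp) / 2)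
      ∂(stdGaussian (EuclideanSpace ℝ ι)) = (√(1 + S).det)⁻¹ := by
  set b := hS.1.eigenvectorBasis
  have hq (y : ι → ℝ) : (∑ i, y i • b i).ofLp ⬝ᵥ S *ᵥ (∑ i, y i • b i).ofLp =
      ∑ i, hS.1.eigenvalues i * y i ^ 2 := by
    have h1 : S *ᵥ (∑ i, y i • b i).ofLp = (∑ i, (y i * hS.1.eigenvalues i) • b i).ofLp := by
      rw [WithLp.ofLp_sum, WithLp.ofLp_sum, mulVec_sum]
      refine Finset.sum_congr rfl fun i _ ↦ ?_
      rw [WithLp.ofLp_smul, WithLp.ofLp_smul, mulVec_smul, hS.1.mulVec_eigenvectorBasis, smul_smul]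
    have h2 := b.orthonormal.inner_sum y (fun i ↦ y i * hS.1.eigenvalues i) Finset.univ
    rw [EuclideanSpace.inner_eq_star_dotProduct, star_trivial, dotProduct_comm] at h2
    rw [h1, h2]
    refine Finset.sum_congr rfl fun i _ ↦ ?_
    simp only [conj_trivial]
    ring
  rw [stdGaussian_eq_map_pi_orthonormalBasis b,
    integral_map (Measurable.aemeasurable (by fun_prop))
      (Continuous.aestronglyMeasurable (by fun_prop))]
  simp_rw [hq, ← Finset.sum_neg_distrib, Finset.sum_div, Real.exp_sum]
  rw [integral_fintype_prod_eq_prod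
    (f := fun i y ↦ Real.exp (-(hS.1.eigenvalues i * y ^ 2) / 2))]
  simp_rw [integral_exp_neg_mul_sq_gaussianReal (hS.eigenvalues_nonneg _)]
  have h := det_one_add_smul hS.1 1
  simp only [one_smul, one_mul] at h
  rw [h, Finset.prod_inv_distrib, Real.sqrt_prod]
  exact fun i _ ↦ by linarith [hS.eigenvalues_nonneg i]

/-- The Laplace transform of the squares of the coordinates of a centered Gaussian vector. -/
lemma integral_exp_multivariateGaussian {C : Matrix ι ι ℝ} (hC : C.PosSemidef) {l : ι → ℝ}
    (hl : ∀ i, 0 ≤ l i) :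
    ∫ x, Real.exp (-(∑ i, l i * x i ^ 2) / 2) ∂(multivariateGaussian 0 C) =
      (√(1 + diagonal l * C).det)⁻¹ := by
  set R := CFC.sqrt C with hR
  have hRR : R * R = C := CFC.sqrt_mul_sqrt_self _ hC.nonneg
  have hRh : R.IsHermitian := (CFC.sqrt_nonneg C).isSelfAdjoint
  have hS : (R * diagonal l * R).PosSemidef := by
    have := (PosSemidef.diagonal (d := l) hl).conjTranspose_mul_mul_same R
    rwa [hRh.eq] at this
  have hq (x : EuclideanSpace ℝ ι) : ∑ i, l i * (toEuclideanCLM (𝕜 := ℝ) R x) i ^ 2 =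
      x.ofLp ⬝ᵥ (R * diagonal l * R) *ᵥ x.ofLp := by
    have h1 : (toEuclideanCLM (𝕜 := ℝ) R x).ofLp = R *ᵥ x.ofLp := rfl
    have hRt : Rᵀ = R := hRh
    rw [h1, mul_assoc, ← mulVec_mulVec, dotProduct_mulVec, ← mulVec_transpose, hRt,
      ← mulVec_mulVec]
    simp only [dotProduct, mulVec_diagonal]
    exact Finset.sum_congr rfl fun i _ ↦ by ring
  rw [multivariateGaussian, integral_map (by fun_prop)
    (Continuous.aestronglyMeasurable (by fun_prop))]
  simp_rw [zero_add]
  rw [← hR]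
  simp_rw [hq]
  rw [integral_exp_quadratic_stdGaussian hS, mul_assoc, det_one_add_mul_comm, mul_assoc, hRR]

lemma integrable_exp_neg_sum_mul_sq {C : Matrix ι ι ℝ} {l : ι → ℝ} (hl : ∀ i, 0 ≤ l i) :
    Integrable (fun x : EuclideanSpace ℝ ι ↦ Real.exp (-(∑ i, l i * x i ^ 2) / 2))
      (multivariateGaussian 0 C) := by
  refine Integrable.of_bound (C := 1)
    (Continuous.aestronglyMeasurable (by fun_prop)) (ae_of_all _ fun x ↦ ?_)
  rw [Real.norm_eq_abs, Real.abs_exp, Real.exp_le_one_iff]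
  have : 0 ≤ ∑ i, l i * x i ^ 2 := Finset.sum_nonneg fun i _ ↦ mul_nonneg (hl i) (sq_nonneg _)
  linarith

/-- The Laplace integral is strictly positive, whereas `(√d)⁻¹` is 0 for d ≤ 0. -/
lemma det_one_add_diagonal_mul_pos {C : Matrix ι ι ℝ} (hC : C.PosSemidef) {l : ι → ℝ}
    (hl : ∀ i, 0 ≤ l i) : 0 < (1 + diagonal l * C).det := by
  rw [← Real.sqrt_pos, ← inv_pos, ← integral_exp_multivariateGaussian hC hl]
  exact integral_exp_pos (integrable_exp_neg_sum_mul_sq hl)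

end Laplace

/-! ### Monotonicity along the interpolation -/

section Monotone

variable {ι κ : Type*} [Fintype ι] [DecidableEq ι] [Fintype κ]

lemma prod_sum_mul_exp (q : ι → κ → ℝ) (l : κ → ℝ) (s : ι → ℝ) :
    ∏ i, ∑ k, q i k * Real.exp (-(l k * s i) / 2) =
      ∑ k : ι → κ, (∏ i, q i (k i)) * Real.exp (-(∑ i, l (k i) * s i) / 2) := by
  classical
  rw [Finset.prod_univ_sum, Fintype.piFinset_univ]
  refine Finset.sum_congr rfl fun k _ ↦ ?_
  rw [Finset.prod_mul_distrib, ← Real.exp_sum, ← Finset.sum_div, Finset.sum_neg_distrib]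

lemma integral_prod_sum_exp {C : Matrix ι ι ℝ} (hC : C.PosSemidef) {l : κ → ℝ}
    (hl : ∀ k, 0 ≤ l k) (q : ι → κ → ℝ) :
    ∫ x, ∏ i, ∑ k, q i k * Real.exp (-(l k * x i ^ 2) / 2) ∂(multivariateGaussian 0 C) =
      ∑ k : ι → κ, (∏ i, q i (k i)) * (√(1 + diagonal (fun i ↦ l (k i)) * C).det)⁻¹ := by
  simp_rw [prod_sum_mul_exp q l]
  rw [integral_finsetSum _ fun k _ ↦ (integrable_exp_neg_sum_mul_sq fun i ↦ hl _).const_mul _]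
  refine Finset.sum_congr rfl fun k _ ↦ ?_
  rw [integral_const_mul, integral_exp_multivariateGaussian hC fun i ↦ hl _]

/-- The cubes of the Laplace transforms are the Laplace transforms of the sums of squares of three
independent copies. -/
lemma sum_mul_inv_sqrt_det_pow_three_nonneg {C : Matrix ι ι ℝ} (hC : C.PosSemidef) {l : κ → ℝ}
    (hl : ∀ k, 0 ≤ l k) {q : ι → κ → ℝ}
    (hq : ∀ i s, 0 ≤ s → 0 ≤ ∑ k, q i k * Real.exp (-(l k * s) / 2)) :
    0 ≤ ∑ k : ι → κ, (∏ i, q i (k i)) *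
      (√(1 + diagonal (fun i ↦ l (k i)) * C).det)⁻¹ ^ 3 := by
  set μ := multivariateGaussian 0 C
  let T (k : ι → κ) (x : EuclideanSpace ℝ ι) : ℝ := Real.exp (-(∑ i, l (k i) * x i ^ 2) / 2)
  have hT (k : ι → κ) : Integrable (T k) μ := integrable_exp_neg_sum_mul_sq fun i ↦ hl _
  have h1 (k : ι → κ) : (√(1 + diagonal (fun i ↦ l (k i)) * C).det)⁻¹ ^ 3 =
      ∫ z, T k z.1 * (T k z.2.1 * T k z.2.2) ∂(μ.prod (μ.prod μ)) := by
    rw [integral_prod_mul (T k) (fun z : EuclideanSpace ℝ ι × EuclideanSpace ℝ ι ↦ T k z.1 * T k z.2),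
      integral_prod_mul, integral_exp_multivariateGaussian hC fun i ↦ hl _]
    ring
  simp_rw [h1, ← integral_const_mul]
  rw [← integral_finsetSum _ fun k _ ↦ ((hT k).mul_prod ((hT k).mul_prod (hT k))).const_mul _]
  refine integral_nonneg fun z ↦ ?_
  have h2 := prod_sum_mul_exp q l (fun i ↦ z.1 i ^ 2 + (z.2.1 i ^ 2 + z.2.2 i ^ 2))
  have h3 (k : ι → κ) : T k z.1 * (T k z.2.1 * T k z.2.2) =
      Real.exp (-(∑ i, l (k i) * (z.1 i ^ 2 + (z.2.1 i ^ 2 + z.2.2 i ^ 2))) / 2) := by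
    simp only [T, ← Real.exp_add, mul_add, Finset.sum_add_distrib]
    ring_nf
  simp_rw [h3]
  rw [Pi.zero_apply, ← h2]
  exact Finset.prod_nonneg fun i _ ↦ hq i _ (by positivity)

lemma monotoneOn_sum_inv_sqrt_det {C : Matrix ι ι ℝ} (hC : C.PosSemidef) {σ : ι → ℝ}
    (hσ : ∀ i, σ i * σ i = 1) {l : κ → ℝ} (hl : ∀ k, 0 ≤ l k) {q : κ → ℝ}
    (hq : ∀ s, 0 ≤ s → 0 ≤ ∑ k, q k * Real.exp (-(l k * s) / 2))
    (hq' : ∀ s, 0 ≤ s → 0 ≤ ∑ k, q k * l k * Real.exp (-(l k * s) / 2)) :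
    MonotoneOn (fun t ↦ ∑ k : ι → κ, (∏ i, q (k i)) *
      (√(1 + diagonal (fun i ↦ l (k i)) * interp σ C t).det)⁻¹) (Icc 0 1) := by
  let d (J : Finset ι) (t : ℝ) : ℝ := (interp σ (padded J C) t).det
  have hdet (k : ι → κ) (t : ℝ) : (1 + diagonal (fun i ↦ l (k i)) * interp σ C t).det =
      ∑ J : Finset ι, (∏ i ∈ J, l (k i)) * d J t := by
    simp only [det_one_add_diagonal_mul, padded_interp hσ, d]
  have hpsd {t : ℝ} (ht : t ∈ Icc (0 : ℝ) 1) : (interp σ C t).PosSemidef :=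
    posSemidef_interp hC ⟨by linarith [ht.1], ht.2⟩
  have hderiv {t : ℝ} (ht : t ∈ Icc (0 : ℝ) 1) :
      HasDerivAt (fun t ↦ ∑ k : ι → κ, (∏ i, q (k i)) *
        (√(1 + diagonal (fun i ↦ l (k i)) * interp σ C t).det)⁻¹)
      (∑ J : Finset ι, (-deriv (d J) t / 2) * ∑ k : ι → κ,
        (∏ i, (if i ∈ J then q (k i) * l (k i) else q (k i))) *
          (√(1 + diagonal (fun i ↦ l (k i)) * interp σ C t).det)⁻¹ ^ 3) t := by
    have h1 (k : ι → κ) : HasDerivAt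
        (fun t ↦ (1 + diagonal (fun i ↦ l (k i)) * interp σ C t).det)
        (∑ J : Finset ι, (∏ i ∈ J, l (k i)) * deriv (d J) t) t := by
      simp_rw [hdet k]
      exact HasDerivAt.fun_sum fun J _ ↦
        ((differentiable_det_interp σ (padded J C)) t).hasDerivAt.const_mul _
    have hpos (k : ι → κ) := det_one_add_diagonal_mul_pos (hpsd ht) (fun i ↦ hl (k i))
    refine (HasDerivAt.fun_sum fun k _ ↦ (((h1 k).sqrt (hpos k).ne').inv
      (Real.sqrt_pos.2 (hpos k)).ne').const_mul (∏ i, q (k i))).congr_deriv ?_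
    simp_rw [Finset.mul_sum]
    rw [Finset.sum_comm]
    refine Finset.sum_congr rfl fun k _ ↦ ?_
    have h2 (J : Finset ι) : ∏ i, (if i ∈ J then q (k i) * l (k i) else q (k i)) =
        (∏ i, q (k i)) * ∏ i ∈ J, l (k i) := by
      have (i : ι) : (if i ∈ J then q (k i) * l (k i) else q (k i)) =
          q (k i) * (if i ∈ J then l (k i) else 1) := by split_ifs <;> simp
      simp_rw [this]
      rw [Finset.prod_mul_distrib, Finset.prod_ite_mem, Finset.univ_inter]
    have h4 := (Real.sqrt_pos.2 (hpos k)).ne'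
    set r := √(1 + diagonal (fun i ↦ l (k i)) * interp σ C t).det
    have h3 (D : ℝ) : -(D / (2 * r)) / r ^ 2 = D * (-1 / 2 * r⁻¹ ^ 3) := by field_simp
    rw [h3, Finset.sum_mul, Finset.mul_sum]
    refine Finset.sum_congr rfl fun J _ ↦ ?_
    rw [h2]
    ring
  refine monotoneOn_of_deriv_nonneg (convex_Icc 0 1)
    (fun t ht ↦ (hderiv ht).continuousAt.continuousWithinAt)
    (fun t ht ↦ (hderiv (interior_subset ht)).differentiableAt.differentiableWithinAt)
    fun t ht ↦ ?_
  have ht' := interior_subset ht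
  rw [(hderiv ht').deriv]
  refine Finset.sum_nonneg fun J _ ↦ mul_nonneg ?_ ?_
  -- The minor is antitone only on [0, 1]; at interior points the derivative within this interval is
  -- the full one.
  · have h : derivWithin (d J) (Icc 0 1) t ≤ 0 :=
      (antitoneOn_det_interp hσ (posSemidef_padded J hC)).derivWithin_nonpos
    rw [derivWithin_of_mem_nhds (mem_interior_iff_mem_nhds.1 ht)] at h
    linarith
  · refine sum_mul_inv_sqrt_det_pow_three_nonneg (hpsd ht') hl
      -- Up to the factor -2, the weights `q k * l k` are those of the derivative in s of ∑ q
      -- e^(-ls/2).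
      (q := fun i k ↦ if i ∈ J then q k * l k else q k) fun i s hs ↦ ?_
    by_cases hi : i ∈ J
    · simpa [hi] using hq' s hs
    · simpa [hi] using hq s hs

end Monotone

/-! ### From matrices to linear functionals of a Gaussian measure -/

section Functional

variable {E : Type*} [NormedAddCommGroup E] [InnerProductSpace ℝ E]
variable {ι ι' κ : Type*}

/-- The continuous linear map `x ↦ (⟪v i, x⟫)ᵢ`. -/
noncomputable def innerMap (v : ι → E) : E →L[ℝ] EuclideanSpace ℝ ι :=
  (EuclideanSpace.equiv ι ℝ).symm.toContinuousLinearMap ∘L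
    ContinuousLinearMap.pi fun i ↦ innerSL ℝ (v i)

lemma innerMap_apply (v : ι → E) (x : E) (i : ι) : innerMap v x i = ⟪v i, x⟫ := rfl

variable [MeasurableSpace E] [BorelSpace E]

/-- The covariance matrix under `μ` of the linear functionals represented by the vectors `v i`. -/
noncomputable def covMatrix (μ : Measure E) (v : ι → E) : Matrix ι ι ℝ :=
  Matrix.of fun i j ↦ covarianceBilin μ (v i) (v j)

lemma posSemidef_covMatrix [Fintype ι] (μ : Measure E) (v : ι → E) : (covMatrix μ v).PosSemidef := by
  refine PosSemidef.of_dotProduct_mulVec_nonneg ?_ fun x ↦ ?_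
  · ext i j
    simp [covMatrix, covarianceBilin_comm]
  · have h : star x ⬝ᵥ covMatrix μ v *ᵥ x =
        covarianceBilin μ (∑ i, x i • v i) (∑ i, x i • v i) := by
      simp only [star_trivial, dotProduct, mulVec, covMatrix, of_apply, map_sum, map_smul,
        _root_.sum_apply, _root_.smul_apply, smul_eq_mul, Finset.mul_sum]
      rw [Finset.sum_comm]
      exact Finset.sum_congr rfl fun i _ ↦ Finset.sum_congr rfl fun j _ ↦ by ring
    rw [h]
    exact covarianceBilin_self_nonneg _

lemma interp_covMatrix_sum_zero [Fintype ι] [DecidableEq ι] [Fintype ι'] [DecidableEq ι']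
    (μ : Measure E) (v : ι → E) (w : ι' → E) :
    interp (Sum.elim (fun _ ↦ 1) (fun _ ↦ -1)) (covMatrix μ (Sum.elim v w)) 0 =
      fromBlocks (covMatrix μ v) 0 0 (covMatrix μ w) := by
  ext i j
  rcases i with i | i <;> rcases j with j | j <;>
    simp [interp, covMatrix] <;> ring

variable [FiniteDimensional ℝ E] [Fintype ι] [DecidableEq ι] [Fintype ι'] [DecidableEq ι'] [Fintype κ]

lemma map_innerMap {μ : Measure E} [IsGaussian μ] (hμ : ∫ x, x ∂μ = 0) (v : ι → E) :
    μ.map (innerMap v) = multivariateGaussian 0 (covMatrix μ v) := by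
  apply IsGaussian.ext
  · simp only [id_eq, integral_id_multivariateGaussian]
    rw [ContinuousLinearMap.integral_id_map IsGaussian.integrable_id, hμ, map_zero]
  rw [← ContinuousLinearMap.toBilinForm_inj]
  refine LinearMap.BilinForm.ext_basis (EuclideanSpace.basisFun ι ℝ).toBasis fun i j ↦ ?_
  rw [ContinuousLinearMap.toBilinForm_apply, ContinuousLinearMap.toBilinForm_apply,
    covarianceBilin_map IsGaussian.memLp_two_id,
    covarianceBilin_multivariateGaussian (posSemidef_covMatrix μ v)]
  have h (i : ι) : (innerMap v).adjoint ((EuclideanSpace.basisFun ι ℝ).toBasis i) = v i := by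
    refine ext_inner_right ℝ fun x ↦ ?_
    rw [ContinuousLinearMap.adjoint_inner_left]
    simp [PiLp.inner_apply, innerMap_apply]
  rw [h, h]
  simp [covMatrix]

lemma integral_prod_sum_exp_inner {μ : Measure E} [IsGaussian μ] (hμ : ∫ x, x ∂μ = 0)
    (v : ι → E) {l : κ → ℝ} (hl : ∀ k, 0 ≤ l k) (q : κ → ℝ) :
    ∫ x, ∏ i, ∑ k, q k * Real.exp (-(l k * ⟪v i, x⟫ ^ 2) / 2) ∂μ =
      ∑ k : ι → κ, (∏ i, q (k i)) *
        (√(1 + diagonal (fun i ↦ l (k i)) * covMatrix μ v).det)⁻¹ := by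
  rw [← integral_prod_sum_exp (posSemidef_covMatrix μ v) hl (fun _ ↦ q), ← map_innerMap hμ v,
    integral_map (by fun_prop) (Continuous.aestronglyMeasurable (by fun_prop))]
  rfl

lemma integral_mul_integral_le_integral_prod_sum_exp {μ : Measure E} [IsGaussian μ]
    (hμ : ∫ x, x ∂μ = 0) (v : ι → E) (w : ι' → E) {l : κ → ℝ} (hl : ∀ k, 0 ≤ l k) {q : κ → ℝ}
    (hq : ∀ s, 0 ≤ s → 0 ≤ ∑ k, q k * Real.exp (-(l k * s) / 2))
    (hq' : ∀ s, 0 ≤ s → 0 ≤ ∑ k, q k * l k * Real.exp (-(l k * s) / 2)) :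
    (∫ x, ∏ i, ∑ k, q k * Real.exp (-(l k * ⟪v i, x⟫ ^ 2) / 2) ∂μ) *
      (∫ x, ∏ i, ∑ k, q k * Real.exp (-(l k * ⟪w i, x⟫ ^ 2) / 2) ∂μ) ≤
    ∫ x, (∏ i, ∑ k, q k * Real.exp (-(l k * ⟪v i, x⟫ ^ 2) / 2)) *
      (∏ i, ∑ k, q k * Real.exp (-(l k * ⟪w i, x⟫ ^ 2) / 2)) ∂μ := by
  have h1 := integral_prod_sum_exp_inner hμ (Sum.elim v w) hl q
  simp only [Fintype.prod_sum_type, Sum.elim_inl, Sum.elim_inr] at h1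
  rw [h1, integral_prod_sum_exp_inner hμ v hl, integral_prod_sum_exp_inner hμ w hl]
  have hmono := monotoneOn_sum_inv_sqrt_det (posSemidef_covMatrix μ (Sum.elim v w))
    (σ := Sum.elim (fun _ ↦ 1) (fun _ ↦ -1)) (by rintro (i | i) <;> simp) hl hq hq'
    (left_mem_Icc.2 zero_le_one) (right_mem_Icc.2 zero_le_one) zero_le_one
  simp only [interp_one, interp_covMatrix_sum_zero, Fintype.prod_sum_type] at hmono
  refine le_trans (le_of_eq ?_) hmono
  -- At t = 0 the determinant splits into blocks, so each term factors according to the two halves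
  -- of k.
  rw [Finset.sum_mul_sum, ← Fintype.sum_prod_type',
    ← (Equiv.sumArrowEquivProdArrow ι ι' κ).sum_comp]
  refine Finset.sum_congr rfl fun k _ ↦ ?_
  have hdet : (1 + diagonal (fun i ↦ l (k i)) *
      fromBlocks (covMatrix μ v) 0 0 (covMatrix μ w)).det =
      (1 + diagonal (fun i ↦ l (k (Sum.inl i))) * covMatrix μ v).det *
      (1 + diagonal (fun i ↦ l (k (Sum.inr i))) * covMatrix μ w).det := by
    have h2 : (diagonal (fun i ↦ l (k i)) : Matrix (ι ⊕ ι') (ι ⊕ ι') ℝ) =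
        fromBlocks (diagonal fun i ↦ l (k (Sum.inl i))) 0 0
          (diagonal fun i ↦ l (k (Sum.inr i))) := by
      rw [fromBlocks_diagonal]
      congr 1
      ext (i | i) <;> rfl
    rw [h2, fromBlocks_multiply, ← fromBlocks_one, fromBlocks_add]
    simp
  rw [hdet, Real.sqrt_mul (det_one_add_diagonal_mul_pos (posSemidef_covMatrix μ v)
    fun i ↦ hl _).le, mul_inv]
  simp only [Equiv.sumArrowEquivProdArrow, Equiv.coe_fn_mk, Function.comp_apply]
  ring

end Functional

/-! ### Strips, approximation of their indicators, and the limit -/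

section Strips

variable {E : Type*} [NormedAddCommGroup E] [InnerProductSpace ℝ E] [FiniteDimensional ℝ E]

/-- By symmetry a separating half-space f < s yields |f| < s on K; nonemptiness gives s > 0, which
permits rescaling to 1. -/
lemma exists_strip_of_notMem {K : Set E} (hKclosed : IsClosed K) (hKconvex : Convex ℝ K)
    (hKsymm : ∀ x ∈ K, -x ∈ K) (hKne : K.Nonempty) {x : E} (hx : x ∉ K) :
    ∃ v : E, (∀ y ∈ K, |⟪v, y⟫| ≤ 1) ∧ 1 < |⟪v, x⟫| := by
  obtain ⟨f, s, hf, hs⟩ := geometric_hahn_banach_closed_point hKconvex hKclosed hx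
  have habs (y : E) (hy : y ∈ K) : |f y| < s :=
    abs_lt.2 ⟨by have := hf _ (hKsymm y hy); rw [map_neg] at this; linarith, hf y hy⟩
  obtain ⟨y₀, hy₀⟩ := hKne
  have hs0 : 0 < s := (abs_nonneg _).trans_lt (habs y₀ hy₀)
  refine ⟨s⁻¹ • (InnerProductSpace.toDual ℝ E).symm f, fun y hy ↦ ?_, ?_⟩
  · rw [real_inner_smul_left, InnerProductSpace.toDual_symm_apply, abs_mul, abs_inv,
      abs_of_pos hs0, inv_mul_le_one₀ hs0]
    exact (habs y hy).le
  · rw [real_inner_smul_left, InnerProductSpace.toDual_symm_apply, abs_mul, abs_inv,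
      abs_of_pos hs0, one_lt_inv_mul₀ hs0]
    exact hs.trans_le (le_abs_self _)

/-- Lindelöf: countably many of the open strip complements already cover the complement of K. -/
lemma exists_seq_strips {K : Set E} (hKclosed : IsClosed K) (hKconvex : Convex ℝ K)
    (hKsymm : ∀ x ∈ K, -x ∈ K) (hKne : K.Nonempty) :
    ∃ v : ℕ → E, K = {x | ∀ i, |⟪v i, x⟫| ≤ 1} := by
  let V : Set E := {v | ∀ y ∈ K, |⟪v, y⟫| ≤ 1}
  obtain ⟨T, hT, hTU⟩ := TopologicalSpace.isOpen_iUnion_countable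
    (fun v : V ↦ {x : E | 1 < |⟪(v : E), x⟫|}) fun v ↦ isOpen_lt continuous_const (by fun_prop)
  -- The trivial strip v = 0 is inserted so that the countable family is nonempty, hence the range
  -- of a sequence.
  have h0 : (0 : E) ∈ V := fun y _ ↦ by simp
  obtain ⟨v, hv⟩ := (hT.insert ⟨0, h0⟩).exists_eq_range (insert_nonempty _ _)
  refine ⟨fun i ↦ v i, Subset.antisymm (fun x hx i ↦ (v i).2 x hx) fun x hx ↦ ?_⟩
  by_contra hxK
  obtain ⟨u, hu, hux⟩ := exists_strip_of_notMem hKclosed hKconvex hKsymm hKne hxK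
  have hmem : x ∈ ⋃ v : V, {x : E | 1 < |⟪(v : E), x⟫|} := mem_iUnion.2 ⟨⟨u, hu⟩, hux⟩
  rw [← hTU] at hmem
  obtain ⟨u', hu', hx'⟩ := mem_iUnion₂.1 hmem
  obtain ⟨i, rfl⟩ : u' ∈ range v := hv ▸ mem_insert_of_mem _ hu'
  exact absurd (hx i) (not_le.2 hx')

variable [MeasurableSpace E] [BorelSpace E] {ι ι' : Type*} [Fintype ι] [Fintype ι']

/-- A polynomial in e^(-as) is a combination of exponentials with rates 2ak/2, and `p.derivative` ≥
0 makes it nonincreasing in s. -/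
lemma integral_mul_integral_le_integral_prod_eval {μ : Measure E} [IsGaussian μ]
    (hμ : ∫ x, x ∂μ = 0) (v : ι → E) (w : ι' → E) {a : ℝ} (ha : 0 ≤ a) {p : ℝ[X]}
    (hp : ∀ u ∈ Icc (0 : ℝ) 1, 0 ≤ p.eval u) (hp' : ∀ u ∈ Icc (0 : ℝ) 1, 0 ≤ p.derivative.eval u) :
    (∫ x, ∏ i, p.eval (Real.exp (-(a * ⟪v i, x⟫ ^ 2))) ∂μ) *
      (∫ x, ∏ i, p.eval (Real.exp (-(a * ⟪w i, x⟫ ^ 2))) ∂μ) ≤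
    ∫ x, (∏ i, p.eval (Real.exp (-(a * ⟪v i, x⟫ ^ 2)))) *
      (∏ i, p.eval (Real.exp (-(a * ⟪w i, x⟫ ^ 2)))) ∂μ := by
  classical
  let l (k : Fin (p.natDegree + 1)) : ℝ := 2 * a * k
  have hexp (s : ℝ) (k : Fin (p.natDegree + 1)) :
      Real.exp (-(l k * s) / 2) = Real.exp (-(a * s)) ^ (k : ℕ) := by
    rw [← Real.exp_nat_mul]; simp only [l]; ring_nf
  have h1 (s : ℝ) : p.eval (Real.exp (-(a * s))) =
      ∑ k : Fin (p.natDegree + 1), p.coeff k * Real.exp (-(l k * s) / 2) := by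
    simp_rw [hexp]
    rw [Polynomial.eval_eq_sum_range, ← Fin.sum_univ_eq_sum_range
      (fun k ↦ p.coeff k * Real.exp (-(a * s)) ^ k)]
  have h2 (s : ℝ) : 2 * a * Real.exp (-(a * s)) * p.derivative.eval (Real.exp (-(a * s))) =
      ∑ k : Fin (p.natDegree + 1), p.coeff k * l k * Real.exp (-(l k * s) / 2) := by
    simp_rw [hexp]
    rw [Polynomial.derivative_eval, Polynomial.sum_over_range _ (by simp), Finset.mul_sum,
      ← Fin.sum_univ_eq_sum_range (fun k ↦ 2 * a * Real.exp (-(a * s)) *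
        (p.coeff k * k * Real.exp (-(a * s)) ^ (k - 1)))]
    refine Finset.sum_congr rfl fun ⟨k, hk⟩ _ ↦ ?_
    rcases k with _ | k
    · simp [l]
    · simp only [l, pow_succ, Nat.add_sub_cancel]; ring
  have hu {s : ℝ} (hs : 0 ≤ s) : Real.exp (-(a * s)) ∈ Icc (0 : ℝ) 1 :=
    ⟨(Real.exp_pos _).le, Real.exp_le_one_iff.2 (by linarith [mul_nonneg ha hs])⟩
  simp_rw [h1]
  refine integral_mul_integral_le_integral_prod_sum_exp hμ v w (fun k ↦ by positivity)
    (fun s hs ↦ ?_) fun s hs ↦ ?_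
  · rw [← h1]; exact hp _ (hu hs)
  · rw [← h2]
    have := hp' _ (hu hs)
    positivity

/-- Polynomials that are monotone on `[0, 1]` and converge there to the indicator of `[1/2, 1]`. -/
noncomputable def stepPoly (m : ℕ) : ℝ[X] := 1 - (1 - Polynomial.X ^ m) ^ (m * 2 ^ m)

lemma eval_stepPoly (m : ℕ) (u : ℝ) : (stepPoly m).eval u = 1 - (1 - u ^ m) ^ (m * 2 ^ m) := by
  simp [stepPoly]

lemma eval_stepPoly_mem_Icc (m : ℕ) {u : ℝ} (hu : u ∈ Icc (0 : ℝ) 1) :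
    (stepPoly m).eval u ∈ Icc (0 : ℝ) 1 := by
  have h1 : 0 ≤ 1 - u ^ m := sub_nonneg.2 (pow_le_one₀ hu.1 hu.2)
  have h2 : 1 - u ^ m ≤ 1 := sub_le_self _ (pow_nonneg hu.1 m)
  rw [eval_stepPoly]
  exact ⟨sub_nonneg.2 (pow_le_one₀ h1 h2), sub_le_self _ (pow_nonneg h1 _)⟩

lemma eval_derivative_stepPoly_nonneg (m : ℕ) {u : ℝ} (hu : u ∈ Icc (0 : ℝ) 1) :
    0 ≤ (stepPoly m).derivative.eval u := by
  have h1 : 0 ≤ 1 - u ^ m := sub_nonneg.2 (pow_le_one₀ hu.1 hu.2)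
  have h0 := hu.1
  have h : (stepPoly m).derivative.eval u =
      (m * 2 ^ m : ℕ) * (1 - u ^ m) ^ (m * 2 ^ m - 1) * (m * u ^ (m - 1)) := by
    simp [stepPoly, Polynomial.derivative_pow]
  rw [h]
  positivity

/-- The exponent N = m2^m satisfies N u^m = m(2u)^m, which is at least m for u ≥ 1/2 and tends to 0
for u < 1/2. The bound 1 - y ≤ e^(-y) settles the first case, Bernoulli's inequality the second. -/
lemma tendsto_eval_stepPoly {u : ℝ} (hu : u ∈ Icc (0 : ℝ) 1) :
    Tendsto (fun m ↦ (stepPoly m).eval u) atTop (𝓝 (if 1 / 2 ≤ u then 1 else 0)) := by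
  have hN (m : ℕ) : ((m * 2 ^ m : ℕ) : ℝ) * u ^ m = m * (2 * u) ^ m := by
    push_cast; rw [mul_pow]; ring
  have h1 (m : ℕ) : 0 ≤ 1 - u ^ m := sub_nonneg.2 (pow_le_one₀ hu.1 hu.2)
  simp_rw [eval_stepPoly]
  split_ifs with h
  · have h2 : Tendsto (fun m : ℕ ↦ (1 - u ^ m) ^ (m * 2 ^ m)) atTop (𝓝 0) := by
      refine squeeze_zero (fun m ↦ pow_nonneg (h1 m) _) (fun m ↦ ?_)
        (Real.tendsto_exp_neg_atTop_nhds_zero.comp tendsto_natCast_atTop_atTop)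
      calc (1 - u ^ m) ^ (m * 2 ^ m) ≤ Real.exp (-u ^ m) ^ (m * 2 ^ m) :=
            pow_le_pow_left₀ (h1 m) (Real.one_sub_le_exp_neg _) _
        _ = Real.exp (-(m * (2 * u) ^ m)) := by
            rw [← Real.exp_nat_mul, mul_neg, hN]
        _ ≤ Real.exp (-m) := by
            have : (1 : ℝ) ≤ (2 * u) ^ m := one_le_pow₀ (by linarith)
            exact Real.exp_le_exp.2 (by nlinarith [Nat.cast_nonneg (α := ℝ) m])
    simpa using h2.const_sub 1
  · refine squeeze_zero (fun m ↦ ?_) (fun m ↦ ?_)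
      (tendsto_self_mul_const_pow_of_lt_one (r := 2 * u) (by linarith [hu.1]) (by linarith))
    · exact sub_nonneg.2 (pow_le_one₀ (h1 m) (sub_le_self _ (pow_nonneg hu.1 m)))
    · have := one_add_mul_le_pow (a := -u ^ m) (by linarith [h1 m]) (m * 2 ^ m)
      rw [← sub_eq_add_neg, mul_neg, hN] at this
      linarith

lemma half_le_exp_neg_log_two_mul_sq (r : ℝ) :
    1 / 2 ≤ Real.exp (-(Real.log 2 * r ^ 2)) ↔ |r| ≤ 1 := by
  rw [← Real.log_le_iff_le_exp (by norm_num), one_div, Real.log_inv, neg_le_neg_iff,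
    ← sq_le_one_iff_abs_le_one]
  exact mul_le_iff_le_one_right (Real.log_pos one_lt_two)

lemma tendsto_integral_prod_stepPoly (μ : Measure E) [IsProbabilityMeasure μ] (v : ι → E) :
    Tendsto (fun m ↦ ∫ x, ∏ i, (stepPoly m).eval (Real.exp (-(Real.log 2 * ⟪v i, x⟫ ^ 2))) ∂μ)
      atTop (𝓝 (μ.real {x | ∀ i, |⟪v i, x⟫| ≤ 1})) := by
  classical
  have hmeas : MeasurableSet {x : E | ∀ i, |⟪v i, x⟫| ≤ 1} := by
    rw [ofPred_forall]
    exact (isClosed_iInter fun i ↦ isClosed_le (by fun_prop) continuous_const).measurableSet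
  have hu (i : ι) (x : E) : Real.exp (-(Real.log 2 * ⟪v i, x⟫ ^ 2)) ∈ Icc (0 : ℝ) 1 := by
    refine ⟨(Real.exp_pos _).le, Real.exp_le_one_iff.2 ?_⟩
    have := mul_nonneg (Real.log_nonneg one_le_two) (sq_nonneg ⟪v i, x⟫)
    linarith
  rw [← integral_indicator_one hmeas]
  refine tendsto_integral_of_dominated_convergence (fun _ ↦ 1)
    (fun m ↦ Continuous.aestronglyMeasurable (by fun_prop)) (integrable_const 1)
    (fun m ↦ ae_of_all _ fun x ↦ ?_) (ae_of_all _ fun x ↦ ?_)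
  · rw [Real.norm_eq_abs, Finset.abs_prod]
    refine Finset.prod_le_one (fun _ _ ↦ abs_nonneg _) fun i _ ↦ ?_
    have := eval_stepPoly_mem_Icc m (hu i x)
    rw [abs_of_nonneg this.1]
    exact this.2
  · have h := tendsto_finsetProd Finset.univ fun i (_ : i ∈ Finset.univ) ↦
      tendsto_eval_stepPoly (hu i x)
    simpa only [half_le_exp_neg_log_two_mul_sq, Finset.prod_ite_zero, Finset.prod_const_one,
      Finset.mem_univ, true_imp_iff, indicator_apply, mem_ofPred_eq, Pi.one_apply] using h

/-- The Gaussian correlation inequality for finite intersections of symmetric strips. -/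
lemma measureReal_strips_mul_le {μ : Measure E} [IsGaussian μ] (hμ : ∫ x, x ∂μ = 0)
    (v : ι → E) (w : ι' → E) :
    μ.real {x | ∀ i, |⟪v i, x⟫| ≤ 1} * μ.real {x | ∀ i, |⟪w i, x⟫| ≤ 1} ≤
      μ.real ({x | ∀ i, |⟪v i, x⟫| ≤ 1} ∩ {x | ∀ i, |⟪w i, x⟫| ≤ 1}) := by
  have h := tendsto_integral_prod_stepPoly μ (Sum.elim v w)
  simp only [Fintype.prod_sum_type, Sum.elim_inl, Sum.elim_inr, Sum.forall] at h
  exact le_of_tendsto_of_tendsto'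
    ((tendsto_integral_prod_stepPoly μ v).mul (tendsto_integral_prod_stepPoly μ w)) h fun m ↦
    integral_mul_integral_le_integral_prod_eval hμ v w (Real.log_nonneg one_le_two)
      (fun u hu ↦ (eval_stepPoly_mem_Icc m hu).1) fun u hu ↦ eval_derivative_stepPoly_nonneg m hu

/-- The **Gaussian correlation inequality**. -/
theorem measure_mul_measure_le_measure_inter {μ : Measure E} [IsGaussian μ] (hμ : ∫ x, x ∂μ = 0)
    {K M : Set E} (hKclosed : IsClosed K) (hKconvex : Convex ℝ K) (hKsymm : ∀ x ∈ K, -x ∈ K)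
    (hMclosed : IsClosed M) (hMconvex : Convex ℝ M) (hMsymm : ∀ x ∈ M, -x ∈ M) :
    μ K * μ M ≤ μ (K ∩ M) := by
  rcases K.eq_empty_or_nonempty with rfl | hKne
  · simp
  rcases M.eq_empty_or_nonempty with rfl | hMne
  · simp
  obtain ⟨v, hv⟩ := exists_seq_strips hKclosed hKconvex hKsymm hKne
  obtain ⟨w, hw⟩ := exists_seq_strips hMclosed hMconvex hMsymm hMne
  let A (v : ℕ → E) (n : ℕ) : Set E := {x | ∀ i : Fin n, |⟪v i, x⟫| ≤ 1}
  have hAclosed (v : ℕ → E) (n : ℕ) : IsClosed (A v n) := by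
    simp only [A, ofPred_forall]
    exact isClosed_iInter fun i ↦ isClosed_le (by fun_prop) continuous_const
  have hAanti (v : ℕ → E) : Antitone (A v) := fun m n hmn x hx i ↦ hx (Fin.castLE hmn i)
  have hA (v : ℕ → E) : {x | ∀ i, |⟪v i, x⟫| ≤ 1} = ⋂ n, A v n := by
    ext x
    simp only [A, mem_iInter, mem_ofPred_eq]
    -- The i-th strip first appears in stage i + 1, as its last index.
    exact ⟨fun h n i ↦ h i, fun h i ↦ h (i + 1) (Fin.last i)⟩
  rw [hA] at hv hw
  have hKM : K ∩ M = ⋂ n, A v n ∩ A w n := by rw [hv, hw, iInter_inter_distrib]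
  have hlim : Tendsto (fun n ↦ μ (A v n ∩ A w n)) atTop (𝓝 (μ (K ∩ M))) := by
    rw [hKM]
    exact tendsto_measure_iInter_atTop
      (fun n ↦ ((hAclosed v n).inter (hAclosed w n)).measurableSet.nullMeasurableSet)
      (fun m n hmn ↦ inter_subset_inter (hAanti v hmn) (hAanti w hmn)) ⟨0, measure_ne_top _ _⟩
  refine ge_of_tendsto' hlim fun n ↦ ?_
  calc μ K * μ M ≤ μ (A v n) * μ (A w n) := by
        gcongr
        · exact hv ▸ iInter_subset _ n
        · exact hw ▸ iInter_subset _ n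
    _ ≤ μ (A v n ∩ A w n) := by
        have h := measureReal_strips_mul_le hμ (fun i : Fin n ↦ v i) (fun i : Fin n ↦ w i)
        rw [measureReal_def, measureReal_def, measureReal_def, ← ENNReal.toReal_mul] at h
        exact (ENNReal.toReal_le_toReal (ENNReal.mul_ne_top (measure_ne_top _ _)
          (measure_ne_top _ _)) (measure_ne_top _ _)).1 h

end Strips

end GaussianCorrelation


theorem mainTheorem1 (n : ℕ)
    (μ : MeasureTheory.Measure (EuclideanSpace ℝ (Fin n)))
    (hμ : ProbabilityTheory.IsGaussian μ)
    (hmean : ∫ x, x ∂μ = 0)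
    (K M : Set (EuclideanSpace ℝ (Fin n)))
    (hKclosed : IsClosed K) (hKconvex : Convex ℝ K) (hKsymm : ∀ x ∈ K, -x ∈ K)
    (hMclosed : IsClosed M) (hMconvex : Convex ℝ M) (hMsymm : ∀ x ∈ M, -x ∈ M) :
    μ (K ∩ M) ≥ μ K * μ M :=
  GaussianCorrelation.measure_mul_measure_le_measure_inter hmean hKclosed hKconvex hKsymm
    hMclosed hMconvex hMsymm
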